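/- Let $n\ge 3$, and let a subgroup $\Gamma$ of the symmetric group $\mathrm{Sym}(n)$ on $[n]=\{1,\dots,n\}$ act on $\mathbb{R}^n$ by permuting coordinates. Suppose that $\Gamma$ is $2$-homogeneous, i.e. for any two $2$-element subsets $X,Y\subset[n]$ there is $\gamma\in\Gamma$ with $\gamma X=Y$. Let $z\in\mathbb{Z}^n$ be a core point with respect to $\Gamma$, i.e. an integral point with $\operatorname{conv}(\Gamma z)\cap\mathbb{Z}^n=\Gamma z$. Let $\langle\cdot,\cdot\rangle$ and $\|\cdot\|$ be the standard inner product and the Euclidean norm on $\mathbb{R}^n$, let $\mathbf{1}=(1,\dots,1)$ be the all-ones vector, and suppose that $\langle z,\mathbf{1}\rangle=\sum_{i=1}^n z_i=k$ with $k\in\{1,\dots,n-1\}$. Let $z|_{\operatorname{lin}\mathbf{1}}$ denote the orthogonal projection of $z$ onto the line spanned by $\mathbf{1}$, that is, $z|_{\operatorname{lin}\mathbf{1}}=\frac{k}{n}\mathbf{1}$. Then $$\bigl\| z - z|_{\operatorname{lin}\mathbf{1}} \bigr\| < (n-1)\sqrt{\frac{k(n-k)}{n}}.$$ -/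

import Mathlib

/-- A permutation group `Γ ≤ Sym(n)` is `k`-homogeneous if for any two `k`-element subsets
`X, Y` of the underlying set some `γ ∈ Γ` satisfies `γ X = Y`. -/
def IsHomogeneousPermGroup {n : ℕ} (Γ : Subgroup (Equiv.Perm (Fin n))) (k : ℕ) : Prop :=
  ∀ X Y : Finset (Fin n), X.card = k → Y.card = k → ∃ γ ∈ Γ, X.image γ = Y

/-- The all-ones vector of `ℝⁿ`. -/
def allOnes (n : ℕ) : EuclideanSpace ℝ (Fin n) :=
  WithLp.toLp 2 (fun _ => (1 : ℝ))

/-- The action of a permutation on `ℝⁿ` by permuting coordinates: `γ eᵢ = e_{γ i}`. -/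
def permuteCoords {n : ℕ} (γ : Equiv.Perm (Fin n)) (x : EuclideanSpace ℝ (Fin n)) :
    EuclideanSpace ℝ (Fin n) :=
  WithLp.toLp 2 (fun i => x (γ⁻¹ i))

/-- The orbit `Γ z` of a point `z ∈ ℝⁿ` under permutation of coordinates. -/
def permOrbit {n : ℕ} (Γ : Subgroup (Equiv.Perm (Fin n))) (z : EuclideanSpace ℝ (Fin n)) :
    Set (EuclideanSpace ℝ (Fin n)) :=
  {y | ∃ γ ∈ Γ, y = permuteCoords γ z}

/-- The set `ℤⁿ` of integral points of `ℝⁿ`. -/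
def integralPoints (n : ℕ) : Set (EuclideanSpace ℝ (Fin n)) :=
  {x | ∀ i, ∃ m : ℤ, x i = (m : ℝ)}

/-- A core point with respect to `Γ` is an integral point `z` such that
`conv(Γ z) ∩ ℤⁿ = Γ z`. -/
def IsCorePoint {n : ℕ} (Γ : Subgroup (Equiv.Perm (Fin n)))
    (z : EuclideanSpace ℝ (Fin n)) : Prop :=
  z ∈ integralPoints n ∧
    convexHull ℝ (permOrbit Γ z) ∩ integralPoints n = permOrbit Γ z

/-!
Let `w = z - (k/n)𝟏` be the component of `z` orthogonal to `𝟏` and `R = ‖w‖`. The core of the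
argument is that `conv(Γ z)` contains the ball of radius `R / (n - 1)` around `(k/n)𝟏` in the
hyperplane `∑ xᵢ = k`.

By 2-homogeneity the matrix `∑_γ (γ w)(γ w)ᵀ` is constant off the diagonal, and its rows sum to
zero, so it is a multiple of the orthogonal projection onto `𝟏ᗮ`; comparing traces identifies the
multiple (`sum_sq_dotProduct_orbit`). As the orbit of `w` also has barycentre `0`, the numbers
`t_γ = ⟨γ w, u⟩` have mean `0` and mean square `R² ‖u‖² / (n - 1)` for each `u ∈ 𝟏ᗮ`. They lie in
`[-R ‖u‖, h]` with `h = max t_γ`, and summing `(h - t_γ)(t_γ + R ‖u‖) ≥ 0` over `Γ` gives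
`h ≥ R ‖u‖ / (n - 1)` (`exists_norm_mul_norm_le_dotProduct_orbit`). By separation of convex sets
this lower bound on the support function puts the ball inside `conv(Γ z)`
(`mem_convexHull_permOrbit`).

The 0/1-vectors with `k` ones lie at distance `√(k(n-k)/n)` from `(k/n)𝟏`. If
`R ≥ (n - 1) √(k(n-k)/n)`, they are all in `conv(Γ z)`, hence in `Γ z` because `z` is a core point;
but then `R = √(k(n-k)/n)`, which is impossible as `n - 1 > 1` and `0 < k < n`.
-/

/-! ### Averages over a homogeneous permutation group -/

/-- Every permutation mapping `{i, l}` onto `{j, l}`, with `l` a third point, maps `i` to `j` either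
by itself or by its square. -/
theorem IsHomogeneousPermGroup.exists_apply_eq {n : ℕ} (hn : 3 ≤ n)
    {Γ : Subgroup (Equiv.Perm (Fin n))} (hΓ : IsHomogeneousPermGroup Γ 2) (i j : Fin n) :
    ∃ γ ∈ Γ, γ i = j := by
  by_cases hij : i = j
  · exact ⟨1, Γ.one_mem, by simp [hij]⟩
  obtain ⟨l, hl⟩ : ∃ l, l ∉ ({i, j} : Finset (Fin n)) := by
    apply Finset.exists_mem_notMem_of_card_lt_card (s := {i, j}) (t := Finset.univ) _ |>.imp
    · exact fun l h => h.2
    · rw [Finset.card_pair hij, Finset.card_univ, Fintype.card_fin]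
      omega
  simp only [Finset.mem_insert, Finset.mem_singleton, not_or] at hl
  obtain ⟨γ, hγ, h⟩ := hΓ {i, l} {j, l} (Finset.card_pair (Ne.symm hl.1))
    (Finset.card_pair (Ne.symm hl.2))
  have hi : γ i ∈ ({j, l} : Finset (Fin n)) := h ▸ Finset.mem_image_of_mem γ (by simp)
  have hl' : γ l ∈ ({j, l} : Finset (Fin n)) := h ▸ Finset.mem_image_of_mem γ (by simp)
  simp only [Finset.mem_insert, Finset.mem_singleton] at hi hl'
  rcases hi with hi | hi
  · exact ⟨γ, hγ, hi⟩
  · refine ⟨γ * γ, Γ.mul_mem hγ hγ, ?_⟩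
    rcases hl' with hl' | hl'
    · simp [hi, hl']
    · exact absurd (γ.injective (hi.trans hl'.symm)) (Ne.symm hl.1)

/-- The orbit of a vector in `𝟏ᗮ` has barycentre `0`. -/
theorem sum_orbit_apply_eq_zero {n : ℕ} (hn : 3 ≤ n)
    {Γ : Subgroup (Equiv.Perm (Fin n))} [Fintype Γ] (hΓ : IsHomogeneousPermGroup Γ 2)
    {w : Fin n → ℝ} (hw : ∑ i, w i = 0) (i : Fin n) :
    ∑ γ : Γ, w ((γ : Equiv.Perm (Fin n))⁻¹ i) = 0 := by
  have hconst : ∀ j, ∑ γ : Γ, w ((γ : Equiv.Perm (Fin n))⁻¹ j)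
      = ∑ γ : Γ, w ((γ : Equiv.Perm (Fin n))⁻¹ i) := by
    intro j
    obtain ⟨σ, hσ, rfl⟩ := hΓ.exists_apply_eq hn i j
    rw [← Equiv.sum_comp (Equiv.mulLeft (⟨σ, hσ⟩ : Γ))]
    simp
  have hsum : ∑ j, ∑ γ : Γ, w ((γ : Equiv.Perm (Fin n))⁻¹ j) = 0 := by
    rw [Finset.sum_comm]
    refine Finset.sum_eq_zero fun γ _ => ?_
    rw [Equiv.sum_comp, hw]
  simp only [hconst, Finset.sum_const, Finset.card_univ, Fintype.card_fin, nsmul_eq_mul] at hsum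
  have : (n : ℝ) ≠ 0 := by positivity
  exact (mul_eq_zero.1 hsum).resolve_left this

/-- By 2-homogeneity, the second moments `∑_γ (γ w)ᵢ (γ w)ⱼ` agree for all `i ≠ j`. -/
theorem exists_sum_orbit_mul_eq {n : ℕ} (hn : 3 ≤ n)
    {Γ : Subgroup (Equiv.Perm (Fin n))} [Fintype Γ] (hΓ : IsHomogeneousPermGroup Γ 2)
    (w : Fin n → ℝ) :
    ∃ c : ℝ, ∀ i j, i ≠ j → ∑ γ : Γ, w ((γ : Equiv.Perm (Fin n))⁻¹ i) *
      w ((γ : Equiv.Perm (Fin n))⁻¹ j) = c := by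
  let a : Fin n := ⟨0, by omega⟩
  let b : Fin n := ⟨1, by omega⟩
  have hab : a ≠ b := by simp [a, b]
  refine ⟨∑ γ : Γ, w ((γ : Equiv.Perm (Fin n))⁻¹ a) * w ((γ : Equiv.Perm (Fin n))⁻¹ b), ?_⟩
  intro i j hij
  obtain ⟨σ, hσ, h⟩ := hΓ {a, b} {i, j} (Finset.card_pair hab) (Finset.card_pair hij)
  have hinv : ∀ p q, ∑ γ : Γ, w ((γ : Equiv.Perm (Fin n))⁻¹ (σ p)) *
      w ((γ : Equiv.Perm (Fin n))⁻¹ (σ q)) = ∑ γ : Γ, w ((γ : Equiv.Perm (Fin n))⁻¹ p) *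
      w ((γ : Equiv.Perm (Fin n))⁻¹ q) := by
    intro p q
    rw [← Equiv.sum_comp (Equiv.mulLeft (⟨σ, hσ⟩ : Γ))]
    simp
  have ha : σ a ∈ ({i, j} : Finset (Fin n)) := h ▸ Finset.mem_image_of_mem σ (by simp)
  have hb : σ b ∈ ({i, j} : Finset (Fin n)) := h ▸ Finset.mem_image_of_mem σ (by simp)
  have hne : σ a ≠ σ b := σ.injective.ne hab
  simp only [Finset.mem_insert, Finset.mem_singleton] at ha hb
  rw [← hinv a b]
  rcases ha with ha | ha <;> rcases hb with hb | hb
  · exact absurd (ha.trans hb.symm) hne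
  · rw [ha, hb]
  · rw [ha, hb]
    exact Finset.sum_congr rfl fun γ _ => mul_comm _ _
  · exact absurd (ha.trans hb.symm) hne

/-- The orbit of `w ∈ 𝟏ᗮ` is isotropic in the `(n - 1)`-dimensional space `𝟏ᗮ`. -/
theorem sum_sq_dotProduct_orbit {n : ℕ} (hn : 3 ≤ n)
    {Γ : Subgroup (Equiv.Perm (Fin n))} [Fintype Γ] (hΓ : IsHomogeneousPermGroup Γ 2)
    {w u : Fin n → ℝ} (hw : ∑ i, w i = 0) (hu : ∑ i, u i = 0) :
    ((n : ℝ) - 1) * ∑ γ : Γ, (∑ i, w ((γ : Equiv.Perm (Fin n))⁻¹ i) * u i) ^ 2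
      = Fintype.card Γ * ((∑ i, w i ^ 2) * ∑ i, u i ^ 2) := by
  obtain ⟨c, hc⟩ := exists_sum_orbit_mul_eq hn hΓ w
  set M : Fin n → Fin n → ℝ := fun i j => ∑ γ : Γ, w ((γ : Equiv.Perm (Fin n))⁻¹ i) *
      w ((γ : Equiv.Perm (Fin n))⁻¹ j) with hM
  have hrow : ∀ i, ∑ j, M i j = 0 := by
    intro i
    simp only [hM]
    rw [Finset.sum_comm]
    refine Finset.sum_eq_zero fun γ _ => ?_
    rw [← Finset.mul_sum, Equiv.sum_comp, hw, mul_zero]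
  -- Off-diagonal entries `c` and vanishing row sums force `M = c (J - n I)`.
  have hdiag : ∀ i, M i i = c - n * c := by
    intro i
    have h := hrow i
    rw [← Finset.add_sum_erase _ _ (Finset.mem_univ i),
      Finset.sum_congr rfl fun j hj => hc i j (Finset.ne_of_mem_erase hj).symm] at h
    rw [Finset.sum_const, Finset.card_erase_of_mem (Finset.mem_univ i), Finset.card_univ,
      Fintype.card_fin, nsmul_eq_mul, Nat.cast_sub (by omega), Nat.cast_one] at h
    linarith
  have hentry : ∀ i j, M i j = c - if i = j then n * c else 0 := by
    intro i j
    by_cases hij : i = j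
    · subst hij
      simp [hdiag]
    · simp only [hij, if_false, sub_zero]
      exact hc i j hij
  have htrace : Fintype.card Γ * ∑ i, w i ^ 2 = n * (c - n * c) := by
    have h : ∑ i, M i i = Fintype.card Γ * ∑ i, w i ^ 2 := by
      simp only [hM]
      rw [Finset.sum_comm]
      have : ∀ γ : Γ, ∑ i, w ((γ : Equiv.Perm (Fin n))⁻¹ i) * w ((γ : Equiv.Perm (Fin n))⁻¹ i)
          = ∑ i, w i ^ 2 := by
        intro γ
        rw [Equiv.sum_comp (γ : Equiv.Perm (Fin n))⁻¹ fun i => w i * w i]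
        simp only [sq]
      simp only [this, Finset.sum_const, Finset.card_univ, nsmul_eq_mul]
    rw [← h]
    simp only [hdiag, Finset.sum_const, Finset.card_univ, Fintype.card_fin, nsmul_eq_mul]
  have hquad : ∑ γ : Γ, (∑ i, w ((γ : Equiv.Perm (Fin n))⁻¹ i) * u i) ^ 2
      = -(n * c) * ∑ i, u i ^ 2 := by
    calc ∑ γ : Γ, (∑ i, w ((γ : Equiv.Perm (Fin n))⁻¹ i) * u i) ^ 2
        = ∑ i, ∑ j, M i j * (u i * u j) := by
          simp only [sq, Finset.sum_mul_sum, hM]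
          rw [Finset.sum_comm]
          refine Finset.sum_congr rfl fun i _ => ?_
          rw [Finset.sum_comm]
          refine Finset.sum_congr rfl fun j _ => ?_
          rw [Finset.sum_mul]
          exact Finset.sum_congr rfl fun γ _ => by ring
      _ = ∑ i, (c * u i * ∑ j, u j - n * c * u i ^ 2) := by
          refine Finset.sum_congr rfl fun i _ => ?_
          simp only [hentry, sub_mul, Finset.sum_sub_distrib, ite_mul, zero_mul,
            Finset.sum_ite_eq, Finset.mem_univ, if_true, Finset.mul_sum]
          congr 1
          · exact Finset.sum_congr rfl fun j _ => by ring
          · ring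
      _ = -(n * c) * ∑ i, u i ^ 2 := by
          simp only [hu, mul_zero, zero_sub, Finset.mul_sum, neg_mul]
  rw [hquad, ← mul_assoc (Fintype.card Γ : ℝ), htrace]
  ring

/-! ### The inscribed ball of an orbit polytope -/

/-- The support function of the orbit of `w` in direction `u` is at least `‖w‖ ‖u‖ / (n - 1)`. -/
theorem exists_norm_mul_norm_le_dotProduct_orbit {n : ℕ} (hn : 3 ≤ n)
    {Γ : Subgroup (Equiv.Perm (Fin n))} (hΓ : IsHomogeneousPermGroup Γ 2)
    {w u : Fin n → ℝ} (hw : ∑ i, w i = 0) (hu : ∑ i, u i = 0) :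
    ∃ γ ∈ Γ, √(∑ i, w i ^ 2) * √(∑ i, u i ^ 2) ≤ ((n : ℝ) - 1) * ∑ i, w (γ⁻¹ i) * u i := by
  classical
  have : Fintype Γ := Fintype.ofFinite Γ
  set t : Γ → ℝ := fun γ => ∑ i, w ((γ : Equiv.Perm (Fin n))⁻¹ i) * u i with ht
  set B := √(∑ i, w i ^ 2) * √(∑ i, u i ^ 2) with hB
  have hB0 : 0 ≤ B := by positivity
  have hB2 : B ^ 2 = (∑ i, w i ^ 2) * ∑ i, u i ^ 2 := by
    rw [hB, mul_pow, Real.sq_sqrt (by positivity), Real.sq_sqrt (by positivity)]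
  have hlow : ∀ γ, -B ≤ t γ := by
    intro γ
    have h := Real.sum_mul_le_sqrt_mul_sqrt Finset.univ
      (fun i => -w ((γ : Equiv.Perm (Fin n))⁻¹ i)) u
    simp only [neg_sq, neg_mul, Finset.sum_neg_distrib] at h
    rw [Equiv.sum_comp (γ : Equiv.Perm (Fin n))⁻¹ fun i => w i ^ 2] at h
    simp only [ht, hB]
    linarith
  obtain ⟨γ₀, -, hmax⟩ := Finset.exists_max_image (Finset.univ : Finset Γ) t Finset.univ_nonempty
  have hmean : ∑ γ, t γ = 0 := by
    simp only [ht]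
    rw [Finset.sum_comm]
    refine Finset.sum_eq_zero fun i _ => ?_
    rw [← Finset.sum_mul, sum_orbit_apply_eq_zero hn hΓ hw, zero_mul]
  have hsq : ((n : ℝ) - 1) * ∑ γ, t γ ^ 2 = Fintype.card Γ * B ^ 2 := by
    rw [hB2]
    exact sum_sq_dotProduct_orbit hn hΓ hw hu
  have hn' : (3 : ℝ) ≤ n := by exact_mod_cast hn
  have hcard : (0 : ℝ) < Fintype.card Γ := by exact_mod_cast Fintype.card_pos
  refine ⟨γ₀, γ₀.2, ?_⟩
  change B ≤ ((n : ℝ) - 1) * t γ₀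
  have hprod : 0 ≤ ∑ γ, (t γ₀ - t γ) * (t γ + B) :=
    Finset.sum_nonneg fun γ _ => mul_nonneg (sub_nonneg.2 (hmax γ (Finset.mem_univ γ)))
      (by linarith [hlow γ])
  have hexp : ∑ γ, (t γ₀ - t γ) * (t γ + B) = Fintype.card Γ * (t γ₀ * B) - ∑ γ, t γ ^ 2 := by
    calc ∑ γ, (t γ₀ - t γ) * (t γ + B)
        = ∑ γ, ((t γ₀ - B) * t γ + t γ₀ * B - t γ ^ 2) :=
          Finset.sum_congr rfl fun γ _ => by ring
      _ = _ := by
          rw [Finset.sum_sub_distrib, Finset.sum_add_distrib, ← Finset.mul_sum, hmean]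
          simp
  rcases hB0.eq_or_lt with h0 | hpos
  · rw [← h0]
    have := hlow γ₀
    rw [← h0, neg_zero] at this
    exact mul_nonneg (by linarith) this
  · have h1 : (Fintype.card Γ : ℝ) * B * B ≤ Fintype.card Γ * B * (((n : ℝ) - 1) * t γ₀) := by
      have := mul_nonneg (by linarith : (0 : ℝ) ≤ (n : ℝ) - 1) hprod
      rw [hexp, mul_sub, hsq] at this
      linarith
    exact le_of_mul_le_mul_left h1 (by positivity)

/-- The polytope `conv(Γ z)` contains every point `x` of the hyperplane `∑ xᵢ = ∑ zᵢ` whose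
distance from the barycentre `m 𝟏` of the orbit is at most `‖z - m 𝟏‖ / (n - 1)`. -/
theorem mem_convexHull_permOrbit {n : ℕ} (hn : 3 ≤ n)
    {Γ : Subgroup (Equiv.Perm (Fin n))} (hΓ : IsHomogeneousPermGroup Γ 2)
    {z x : EuclideanSpace ℝ (Fin n)} {m : ℝ} (hz : ∑ i, (z i - m) = 0) (hx : ∑ i, (x i - m) = 0)
    (hxz : ((n : ℝ) - 1) * √(∑ i, (x i - m) ^ 2) ≤ √(∑ i, (z i - m) ^ 2)) :
    x ∈ convexHull ℝ (permOrbit Γ z) := by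
  by_contra hmem
  have hfin : (permOrbit Γ z).Finite := by
    refine (Set.finite_range fun γ : Equiv.Perm (Fin n) => permuteCoords γ z).subset ?_
    rintro y ⟨γ, -, rfl⟩
    exact ⟨γ, rfl⟩
  obtain ⟨f, s, hs, hsx⟩ := geometric_hahn_banach_closed_point (convex_convexHull ℝ _)
    (hfin.isClosed_convexHull ℝ) hmem
  obtain ⟨a, rfl⟩ := (InnerProductSpace.toDual ℝ (EuclideanSpace ℝ (Fin n))).surjective f
  have hn' : (3 : ℝ) ≤ n := by exact_mod_cast hn
  -- Only the component of the separating direction orthogonal to `𝟏` matters.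
  set b : ℝ := (∑ i, a i) / n with hb
  have hu : ∑ i, (a i - b) = 0 := by
    simp only [Finset.sum_sub_distrib, Finset.sum_const, Finset.card_univ, Fintype.card_fin,
      nsmul_eq_mul, hb]
    field_simp
    ring
  obtain ⟨γ, hγ, hle⟩ := exists_norm_mul_norm_le_dotProduct_orbit hn hΓ hz hu
  have hlt := (hs _ (subset_convexHull ℝ _ ⟨γ, hγ, rfl⟩)).trans hsx
  simp only [InnerProductSpace.toDual_apply_apply, PiLp.inner_apply, RCLike.inner_apply,
    conj_trivial, permuteCoords] at hlt
  have hinner : ∀ y : Fin n → ℝ, ∑ i, (y i - m) = 0 →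
      ∑ i, (y i - m) * (a i - b) = ∑ i, y i * a i - m * ∑ i, a i := by
    intro y hy
    have : ∀ i, (y i - m) * (a i - b) = y i * a i - m * a i - b * (y i - m) := fun i => by ring
    simp only [this, Finset.sum_sub_distrib (fun i => y i * a i - m * a i), ← Finset.mul_sum, hy]
    rw [Finset.sum_sub_distrib, ← Finset.mul_sum, mul_zero, sub_zero]
  have hzγ : ∑ i, (z (γ⁻¹ i) - m) = 0 := by
    rw [Equiv.sum_comp γ⁻¹ fun i => z i - m, hz]
  rw [hinner (fun i => z (γ⁻¹ i)) hzγ] at hle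
  have hcs := Real.sum_mul_le_sqrt_mul_sqrt Finset.univ (fun i => x i - m) (fun i => a i - b)
  rw [hinner _ hx] at hcs
  have h1 := mul_le_mul_of_nonneg_left hcs (by linarith : (0 : ℝ) ≤ (n : ℝ) - 1)
  have h2 := mul_le_mul_of_nonneg_right hxz (Real.sqrt_nonneg (∑ i, (a i - b) ^ 2))
  have h3 := mul_lt_mul_of_pos_left hlt (by linarith : (0 : ℝ) < (n : ℝ) - 1)
  linarith

/-! ### The bound for core points -/

/-- The 0/1-vector whose first `k` coordinates are `1`. -/
def leadingOnes (n k : ℕ) : EuclideanSpace ℝ (Fin n) :=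
  WithLp.toLp 2 fun i => if (i : ℕ) < k then 1 else 0

theorem sum_leadingOnes {n k : ℕ} (hk : k ≤ n) : ∑ i, leadingOnes n k i = k := by
  simp only [leadingOnes]
  rw [Fin.sum_univ_eq_sum_range (fun i => if i < k then (1 : ℝ) else 0) n, Finset.sum_ite]
  have : (Finset.range n).filter (· < k) = Finset.range k := by
    ext i
    simp only [Finset.mem_filter, Finset.mem_range]
    omega
  simp [this]

theorem sum_sq_leadingOnes_sub {n k : ℕ} (hn : 0 < n) (hk : k ≤ n) :
    ∑ i, (leadingOnes n k i - (k : ℝ) / n) ^ 2 = (k : ℝ) * (n - k) / n := by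
  have h : ∀ i, (leadingOnes n k i - (k : ℝ) / n) ^ 2
      = (1 - 2 * (k / n)) * leadingOnes n k i + ((k : ℝ) / n) ^ 2 := by
    intro i
    simp only [leadingOnes]
    split_ifs <;> ring
  simp only [h, Finset.sum_add_distrib, ← Finset.mul_sum, sum_leadingOnes hk, Finset.sum_const,
    Finset.card_univ, Fintype.card_fin, nsmul_eq_mul]
  field_simp
  ring

theorem norm_sub_starProjection_allOnes {n : ℕ} (z : EuclideanSpace ℝ (Fin n)) :
    ‖z - (Submodule.span ℝ {allOnes n}).starProjection z‖
      = √(∑ i, (z i - inner ℝ z (allOnes n) / n) ^ 2) := by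
  have h1 : ‖allOnes n‖ ^ 2 = n := by
    simp [EuclideanSpace.norm_sq_eq, allOnes]
  rw [EuclideanSpace.norm_eq, Submodule.starProjection_singleton, real_inner_comm]
  have h2 : ∀ i, allOnes n i = 1 := fun i => rfl
  simp only [RCLike.ofReal_real_eq_id, id_eq, h1, PiLp.sub_apply, PiLp.smul_apply,
    Real.norm_eq_abs, sq_abs, smul_eq_mul, h2, mul_one]

theorem mainTheorem9 (n : ℕ) (hn : 3 ≤ n) (Γ : Subgroup (Equiv.Perm (Fin n)))
    (hΓ : IsHomogeneousPermGroup Γ 2)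
    (z : EuclideanSpace ℝ (Fin n)) (hz : IsCorePoint Γ z)
    (k : ℕ) (hk : k ∈ Finset.Icc 1 (n - 1)) (hzk : inner ℝ z (allOnes n) = (k : ℝ)) :
    ‖z - (Submodule.span ℝ {allOnes n}).starProjection z‖
      < ((n : ℝ) - 1) * Real.sqrt ((k : ℝ) * ((n : ℝ) - (k : ℝ)) / (n : ℝ)) := by
  obtain ⟨hk1, hk2⟩ := Finset.mem_Icc.1 hk
  have hkn : k < n := by omega
  have hn' : (3 : ℝ) ≤ n := by exact_mod_cast hn
  have hzsum : ∑ i, z i = k := by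
    rw [← hzk]
    simp [PiLp.inner_apply, allOnes]
  have hcenter : ∀ y : EuclideanSpace ℝ (Fin n), ∑ i, y i = k →
      ∑ i, (y i - (k : ℝ) / n) = 0 := by
    intro y hy
    simp only [Finset.sum_sub_distrib, hy, Finset.sum_const, Finset.card_univ, Fintype.card_fin,
      nsmul_eq_mul]
    field_simp
    ring
  rw [norm_sub_starProjection_allOnes, hzk]
  by_contra! hge
  have hpos : 0 < √((k : ℝ) * ((n : ℝ) - k) / n) := by
    have h1 : (0 : ℝ) < k := by exact_mod_cast hk1
    have h2 : (0 : ℝ) < (n : ℝ) - k := sub_pos.2 (by exact_mod_cast hkn)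
    positivity
  have hconv : leadingOnes n k ∈ convexHull ℝ (permOrbit Γ z) := by
    refine mem_convexHull_permOrbit hn hΓ (hcenter z hzsum)
      (hcenter _ (sum_leadingOnes hkn.le)) ?_
    rwa [sum_sq_leadingOnes_sub (by omega) hkn.le]
  have hint : leadingOnes n k ∈ integralPoints n := by
    intro i
    refine ⟨if (i : ℕ) < k then 1 else 0, ?_⟩
    simp [leadingOnes]
  have horbit : leadingOnes n k ∈ permOrbit Γ z := hz.2 ▸ ⟨hconv, hint⟩
  obtain ⟨γ, -, hγ⟩ := horbit
  have hnorm : ∑ i, (z i - (k : ℝ) / n) ^ 2 = (k : ℝ) * (n - k) / n := by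
    rw [← sum_sq_leadingOnes_sub (by omega) hkn.le, hγ]
    exact (Equiv.sum_comp γ⁻¹ fun i => (z i - (k : ℝ) / n) ^ 2).symm
  rw [hnorm] at hge
  nlinarith
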